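/- For a bounded domain (nonempty connected open set) $D \subset \mathbb{C}^n$ let $L^2_a(D)$ be its Bergman space, the space of holomorphic functions on $D$ that are square integrable with respect to Lebesgue measure. The Bergman kernel of $D$ is $$K_D(z,w) = \sum_{j} \phi_j(z)\,\overline{\phi_j(w)}, \qquad (z,w)\in D\times D,$$ where $(\phi_j)$ is a complete orthonormal basis of $L^2_a(D)$; the sum converges and does not depend on the basis. The domain $D$ is called a Lu Qi-Keng domain if $K_D(z,w)\neq 0$ for all $z,w\in D$. Theorem. For all positive real numbers $q$ and $r$ the domain $$\{z=(z_1,z_2,z_3) \in \mathbb{C}^3 : |z_1|^2+|z_2|^q<1,\ |z_1|^2+|z_3|^r<1\}$$ is a Lu Qi-Keng domain. -/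

import Mathlib

open MeasureTheory ComplexConjugate

/-- The Bergman space of `D ⊆ ℂⁿ`: the classes in `L²(D)` (for Lebesgue measure) that have a
representative which is holomorphic on `D`. -/
noncomputable def bergmanSpace {n : ℕ} (D : Set (Fin n → ℂ)) :
    Submodule ℂ (Lp ℂ 2 (volume.restrict D)) where
  carrier := {f | ∃ g : (Fin n → ℂ) → ℂ, DifferentiableOn ℂ g D ∧ f =ᵐ[volume.restrict D] g}
  zero_mem' := ⟨0, differentiableOn_const 0, Lp.coeFn_zero _ _ _⟩
  add_mem' := by
    rintro a b ⟨f, hf, haf⟩ ⟨g, hg, hbg⟩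
    exact ⟨f + g, hf.add hg, (Lp.coeFn_add a b).trans (haf.add hbg)⟩
  smul_mem' := by
    rintro c a ⟨f, hf, haf⟩
    exact ⟨c • f, hf.const_smul c, (Lp.coeFn_smul c a).trans (haf.const_smul c)⟩

/-- `φ` is a complete orthonormal basis of the Bergman space of `D`: a family of square
integrable holomorphic functions on `D` that is orthonormal in `L²(D)` and whose linear span is
dense in the Bergman space. -/
structure IsBergmanBasis {n : ℕ} (D : Set (Fin n → ℂ)) {ι : Type}
    (φ : ι → (Fin n → ℂ) → ℂ) : Prop where
  holomorphic : ∀ j, DifferentiableOn ℂ (φ j) D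
  memLp : ∀ j, MemLp (φ j) 2 (volume.restrict D)
  orthonormal : Orthonormal ℂ (fun j => (memLp j).toLp (φ j))
  complete : bergmanSpace D ≤
    (Submodule.span ℂ (Set.range (fun j => (memLp j).toLp (φ j)))).topologicalClosure

/-- `K` is, on `D × D`, the Bergman kernel of `D`: the Bergman space has a complete orthonormal
basis, and `K z w = ∑ⱼ φⱼ(z) * conj (φⱼ(w))` (a convergent sum) for every such basis `φ`. -/
def IsBergmanKernel {n : ℕ} (D : Set (Fin n → ℂ))
    (K : (Fin n → ℂ) → (Fin n → ℂ) → ℂ) : Prop :=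
  (∃ (ι : Type) (φ : ι → (Fin n → ℂ) → ℂ), IsBergmanBasis D φ) ∧
    ∀ (ι : Type) (φ : ι → (Fin n → ℂ) → ℂ), IsBergmanBasis D φ →
      ∀ z ∈ D, ∀ w ∈ D, HasSum (fun j => φ j z * conj (φ j w)) (K z w)

/-- A Lu Qi-Keng domain: a domain (nonempty connected open set) of `ℂⁿ` whose Bergman kernel
has no zero on `D × D`. -/
structure IsLuQiKengDomain {n : ℕ} (D : Set (Fin n → ℂ)) : Prop where
  isOpen : IsOpen D
  isConnected : IsConnected D
  kernel_ne_zero : ∃ K : (Fin n → ℂ) → (Fin n → ℂ) → ℂ,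
    IsBergmanKernel D K ∧ ∀ z ∈ D, ∀ w ∈ D, K z w ≠ 0

/-! The domain D is complete Reinhardt, so the monomials z^α form an orthogonal system, and every
holomorphic function on D is the sum of its Taylor series, whose terms in the square integrable case
are the projections to the monomials. Hence K is the sum of z^α conj(w^α) / ‖z^α‖²
(`IsCompleteReinhardt.exists_isBergmanKernel_hasSum`).

Put κ = 2/q, μ = 2/r, α = (a, b, c), s = κ(b+1) + μ(c+1). Integrating over the slices with z₁ fixed,
which are products of two discs, and then over z₁ gives ‖z^α‖² = π³ / ((b+1)(c+1) B), where 1/B is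
the Beta integral of tᵃ(1-t)ˢ (`integral_norm_monomialFun_sq`). With x, y, v denoting the products
z_i conj(w_i), the binomial series sums over a to (s+1)(1-x)^(-s-2). Since s is affine in b and c,
the powers of 1-x are absorbed by Y = y/(1-x)^κ and W = v/(1-x)^μ, and geometric-type series give
(`hasSum_triple_series`)

π³ K = (1-x)^(-κ-μ-2) (1-Y)^(-2) (1-W)^(-2) [κ(1+Y)/(1-Y) + μ(1+W)/(1-W) + 1].

On D × D both |Y| and |W| are less than 1 (`norm_mul_norm_lt_one_sub_rpow`,
`norm_div_one_sub_cpow_lt`). The Cayley transform maps the unit disc to the right half-plane, so the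
bracket has positive real part and K cannot vanish. -/

section

/-! ### Fourier coefficients along torus orbits and Taylor expansion on complete Reinhardt domains.
-/

open UnitAddTorus in
theorem mFourierCoeff_eq_integral_pi {n : ℕ} (f : UnitAddTorus (Fin n) → ℂ) (k : Fin n → ℤ) :
    mFourierCoeff f k = ∫ t, mFourier (-k) t * f t
      ∂(Measure.pi fun _ : Fin n => (AddCircle.haarAddCircle : Measure UnitAddCircle)) := rfl

/-- The normalised Haar measure on the torus `(ℝ/ℤ)ⁿ`. -/
noncomputable abbrev torusHaar (n : ℕ) : Measure (UnitAddTorus (Fin n)) :=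
  Measure.pi fun _ => AddCircle.haarAddCircle

theorem norm_fourier_apply (k : ℤ) (t : UnitAddCircle) : ‖fourier k t‖ = 1 := by
  rw [fourier_apply]; exact Circle.norm_coe _

theorem fourier_eq_zpow (k : ℤ) (t : UnitAddCircle) : fourier k t = fourier 1 t ^ k := by
  simp [fourier_apply, AddCircle.toCircle_zsmul]

/-- Integrate the Taylor series at 0 term by term over the circle. The coefficients `a` are chosen
before `c`, which makes the Fourier coefficients homogeneous in `c`. -/
theorem fourierCoeff_holomorphic_dilate {f : ℂ → ℂ} {R : ℝ} (hR : 1 < R)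
    (hf : DifferentiableOn ℂ f (Metric.ball 0 R)) :
    ∃ a : ℕ → ℂ, ∀ c : ℂ, ‖c‖ ≤ 1 →
      (∀ m : ℕ, fourierCoeff (fun t : UnitAddCircle => f (fourier 1 t * c)) m = c ^ m * a m) ∧
      ∀ k : ℤ, k < 0 → fourierCoeff (fun t : UnitAddCircle => f (fourier 1 t * c)) k = 0 := by
  set a : ℕ → ℂ := fun m => (m.factorial : ℂ)⁻¹ * iteratedDeriv m f 0 with ha
  have hs : ∀ z : ℂ, ‖z‖ < R → HasSum (fun m => a m * z ^ m) (f z) := by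
    intro z hz
    have := Complex.hasSum_taylorSeries_on_ball hf (z := z) (by simpa using hz)
    convert! this using 2 with m
    simp only [ha, smul_eq_mul, sub_zero]; ring
  -- Since R > 1, the series converges absolutely at 1, which dominates it for all ‖c‖ ≤ 1 at once.
  have hsum : Summable fun m => ‖a m‖ := by
    simpa using (hs 1 (by simpa using hR)).summable.norm
  have key : ∀ c : ℂ, ‖c‖ ≤ 1 → ∀ k : ℤ,
      HasSum (fun m : ℕ => a m * c ^ m * (Pi.single (M := fun _ : ℤ => ℂ) (m : ℤ) 1 k))
        (fourierCoeff (fun t : UnitAddCircle => f (fourier 1 t * c)) k) := by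
    intro c hc k
    have h1 := hasSum_integral_of_summable_integral_norm
      (μ := (AddCircle.haarAddCircle : Measure UnitAddCircle))
      (F := fun (m : ℕ) t => fourier (-k) t * (a m * c ^ m * fourier (m : ℤ) t)) ?_ ?_
    · convert! h1 using 1
      · ext m
        have : Fact ((0 : ℝ) < 1) := ⟨one_pos⟩
        rw [← fourierCoeff_fourier (T := 1), fourierCoeff, ← integral_const_mul]
        congr 1; ext t; simp; ring
      · rw [fourierCoeff]
        congr 1; ext t
        have := (hs (fourier 1 t * c) (by
          rw [norm_mul, norm_fourier_apply]; linarith)).mul_left (fourier (-k) t)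
        rw [smul_eq_mul, ← this.tsum_eq]
        congr 1; ext m
        rw [fourier_eq_zpow m]; simp [mul_pow]; ring
    · intro m
      have hc : Continuous fun t : UnitAddCircle =>
        fourier (-k) t * (a m * c ^ m * fourier (m : ℤ) t) := by fun_prop
      exact hc.integrable_of_hasCompactSupport (HasCompactSupport.of_compactSpace _)
    · simp only [norm_mul, norm_fourier_apply, norm_pow, one_mul, mul_one, integral_const,
        probReal_univ, smul_eq_mul]
      exact hsum.of_nonneg_of_le (fun m => by positivity) fun m =>
        mul_le_of_le_one_right (norm_nonneg _) (pow_le_one₀ (norm_nonneg _) hc)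
  refine ⟨a, fun c hc => ⟨fun m => ?_, fun k hk => ?_⟩⟩
  · refine (key c hc m).unique ?_
    convert hasSum_single m ?_ using 1
    · simp [mul_comm]
    · intro j hj
      rw [Pi.single_eq_of_ne (by exact_mod_cast hj.symm), mul_zero]
  · refine (key c hc k).unique ?_
    convert! hasSum_zero using 2 with j
    rw [Pi.single_eq_of_ne (by omega), mul_zero]

/-- The action of the torus on `ℂⁿ` by rotations of the coordinates. -/
noncomputable def torusRot {n : ℕ} (t : UnitAddTorus (Fin n)) (z : Fin n → ℂ) : Fin n → ℂ :=
  fun i => fourier 1 (t i) * z i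

theorem norm_torusRot_apply {n : ℕ} (t : UnitAddTorus (Fin n)) (z : Fin n → ℂ) (i : Fin n) :
    ‖torusRot t z i‖ = ‖z i‖ := by
  rw [torusRot, norm_mul, norm_fourier_apply, one_mul]

theorem torusRot_zero {n : ℕ} (z : Fin n → ℂ) : torusRot 0 z = z := by
  ext i; simp [torusRot]

theorem torusRot_add {n : ℕ} (s t : UnitAddTorus (Fin n)) (z : Fin n → ℂ) :
    torusRot (s + t) z = torusRot s (torusRot t z) := by
  ext i; simp only [torusRot, fourier_one, Pi.add_apply, AddCircle.toCircle_add, Circle.coe_mul, mul_assoc]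

theorem continuous_torusRot {n : ℕ} :
    Continuous fun p : UnitAddTorus (Fin n) × (Fin n → ℂ) => torusRot p.1 p.2 := by
  unfold torusRot; fun_prop

/-- A complete Reinhardt set: it contains with each point the closed polydisc spanned by it. -/
def IsCompleteReinhardt {n : ℕ} (D : Set (Fin n → ℂ)) : Prop :=
  ∀ z ∈ D, ∀ w : Fin n → ℂ, (∀ i, ‖w i‖ ≤ ‖z i‖) → w ∈ D

namespace IsCompleteReinhardt

variable {n : ℕ} {D : Set (Fin n → ℂ)}

theorem torusRot_mem (hR : IsCompleteReinhardt D) {z : Fin n → ℂ} (hz : z ∈ D)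
    (t : UnitAddTorus (Fin n)) : torusRot t z ∈ D :=
  hR z hz _ fun i => (norm_torusRot_apply t z i).le

theorem torusRot_mem_iff (hR : IsCompleteReinhardt D) {z : Fin n → ℂ}
    (t : UnitAddTorus (Fin n)) : torusRot t z ∈ D ↔ z ∈ D :=
  ⟨fun h => hR _ h _ fun i => (norm_torusRot_apply t z i).ge, fun h => hR.torusRot_mem h t⟩

theorem exists_one_lt_smul_mem (hD : IsOpen D) {z : Fin n → ℂ} (hz : z ∈ D) :
    ∃ ρ : ℝ, 1 < ρ ∧ (ρ : ℂ) • z ∈ D := by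
  have hc : Continuous fun ρ : ℝ => (ρ : ℂ) • z := by fun_prop
  have h1 : ∀ᶠ ρ : ℝ in nhds (1 : ℝ), (ρ : ℂ) • z ∈ D :=
    hc.continuousAt.eventually_mem (hD.mem_nhds (by simpa using hz))
  have h2 := (h1.filter_mono (nhdsWithin_le_nhds (s := Set.Ioi 1))).and self_mem_nhdsWithin
  obtain ⟨ρ, h, h'⟩ := h2.exists
  exact ⟨ρ, h', h⟩

end IsCompleteReinhardt

/-- The homogeneous component of degree `k` of `g`, the Fourier coefficient of `g` along the
orbits of the torus. -/
noncomputable def torusCoeff {n : ℕ} (g : (Fin n → ℂ) → ℂ) (k : Fin n → ℤ) (z : Fin n → ℂ) : ℂ :=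
  UnitAddTorus.mFourierCoeff (fun t => g (torusRot t z)) k

variable {n : ℕ} {D : Set (Fin n → ℂ)} {g : (Fin n → ℂ) → ℂ}

theorem continuous_comp_torusRot (hR : IsCompleteReinhardt D) (hg : ContinuousOn g D)
    {z : Fin n → ℂ} (hz : z ∈ D) : Continuous fun t => g (torusRot t z) :=
  hg.comp_continuous (continuous_torusRot.comp (by fun_prop : Continuous fun t => (t, z)))
    fun t => hR.torusRot_mem hz t

theorem norm_torusCoeff_le {M : ℝ} {z : Fin n → ℂ} (hM : ∀ t, ‖g (torusRot t z)‖ ≤ M)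
    (k : Fin n → ℤ) : ‖torusCoeff g k z‖ ≤ M := by
  rw [torusCoeff, mFourierCoeff_eq_integral_pi]
  refine (norm_integral_le_of_norm_le_const (C := M) (Filter.Eventually.of_forall fun t => ?_)).trans
    (by simp)
  rw [norm_mul]
  have : ‖UnitAddTorus.mFourier (-k) t‖ = 1 := by
    simp only [UnitAddTorus.mFourier, ContinuousMap.coe_mk, norm_prod, norm_fourier_apply,
      Finset.prod_const_one]
  rw [this, one_mul]; exact hM t

/-- Haar measure is invariant under translation by `s` in the `i`-th coordinate. Averaging over `s`
and applying Fubini isolates a one-variable Fourier coefficient, to which holomorphy in that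
variable applies. -/
theorem torusCoeff_update_eq_integral (hR : IsCompleteReinhardt D)
    (hg : ContinuousOn g D) {z : Fin n → ℂ} (hz : z ∈ D) (i : Fin n) {c : ℂ} (hc : ‖c‖ ≤ 1)
    (k : Fin n → ℤ) :
    torusCoeff g k (Function.update z i (c * z i)) =
      ∫ t, UnitAddTorus.mFourier (-k) t *
        fourierCoeff (fun s : UnitAddCircle =>
          g (torusRot t (Function.update z i (fourier 1 s * c * z i)))) (k i) ∂(torusHaar n) := by
  have hrot : ∀ (t : UnitAddTorus (Fin n)) (s : UnitAddCircle),
      torusRot t (Function.update z i (fourier 1 s * c * z i)) =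
        torusRot (t + Pi.single i s) (Function.update z i (c * z i)) := by
    intro t s
    rw [torusRot_add]
    congr 1
    ext j
    by_cases h : j = i
    · subst h; simp [torusRot, mul_assoc]
    · simp [torusRot, h]
  have hF : ∀ (t : UnitAddTorus (Fin n)) (s : UnitAddCircle),
      UnitAddTorus.mFourier (-k) (t + Pi.single i s) =
        UnitAddTorus.mFourier (-k) t * fourier (-k i) s := by
    intro t s
    have h1 : UnitAddTorus.mFourier (-k) (t + Pi.single i s) =
        UnitAddTorus.mFourier (-k) t * UnitAddTorus.mFourier (-k) (Pi.single i s) := by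
      simp only [UnitAddTorus.mFourier, ContinuousMap.coe_mk, ← Finset.prod_mul_distrib]
      refine Finset.prod_congr rfl fun j _ => ?_
      simp only [fourier_apply, Pi.add_apply, smul_add, AddCircle.toCircle_add, Circle.coe_mul]
    rw [h1]
    congr 1
    simp only [UnitAddTorus.mFourier, ContinuousMap.coe_mk]
    rw [Finset.prod_eq_single i]
    · simp
    · intro j _ hj; simp [Pi.single_eq_of_ne hj]
    · simp
  have hz' : Function.update z i (c * z i) ∈ D := by
    refine hR z hz _ fun j => ?_
    by_cases h : j = i
    · subst h
      simpa using mul_le_of_le_one_left (norm_nonneg (z j)) hc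
    · simp [h]
  set z' := Function.update z i (c * z i)
  have hcont := continuous_comp_torusRot hR hg hz'
  calc torusCoeff g k z' = ∫ _ : UnitAddCircle, torusCoeff g k z' ∂AddCircle.haarAddCircle := by
        simp
    _ = ∫ s : UnitAddCircle, ∫ t, UnitAddTorus.mFourier (-k) t * (fourier (-k i) s *
          g (torusRot (t + Pi.single i s) z')) ∂(torusHaar n) ∂AddCircle.haarAddCircle := by
        congr 1; ext s
        rw [torusCoeff, mFourierCoeff_eq_integral_pi,
          ← integral_add_right_eq_self _ (Pi.single i s : UnitAddTorus (Fin n))]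
        congr 1; ext t
        rw [hF, mul_assoc]
    _ = ∫ t, ∫ s : UnitAddCircle, UnitAddTorus.mFourier (-k) t * (fourier (-k i) s *
          g (torusRot (t + Pi.single i s) z')) ∂AddCircle.haarAddCircle ∂(torusHaar n) := by
        refine integral_integral_swap ?_
        have hc : Continuous (Function.uncurry fun (s : UnitAddCircle) (t : UnitAddTorus (Fin n)) =>
          UnitAddTorus.mFourier (-k) t * (fourier (-k i) s *
            g (torusRot (t + Pi.single i s) z'))) := by
          have h2 : Continuous fun p : UnitAddCircle × UnitAddTorus (Fin n) =>
              g (torusRot (p.2 + Pi.single i p.1) z') :=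
            hcont.comp (continuous_snd.add ((continuous_single i).comp continuous_fst))
          exact ((map_continuous _).comp continuous_snd).mul
            (((map_continuous _).comp continuous_fst).mul h2)
        exact hc.integrable_of_hasCompactSupport (HasCompactSupport.of_compactSpace _)
    _ = _ := by
        congr 1; ext t
        rw [integral_const_mul, fourierCoeff]
        simp only [hrot, smul_eq_mul]

theorem exists_holomorphic_update (hR : IsCompleteReinhardt D) (hD : IsOpen D)
    (hg : DifferentiableOn ℂ g D) {z : Fin n → ℂ} (hz : z ∈ D) (i : Fin n)
    (t : UnitAddTorus (Fin n)) :
    ∃ R : ℝ, 1 < R ∧ DifferentiableOn ℂ (fun c : ℂ => g (torusRot t (Function.update z i (c * z i))))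
      (Metric.ball 0 R) := by
  obtain ⟨ρ, hρ, hρz⟩ := IsCompleteReinhardt.exists_one_lt_smul_mem hD hz
  refine ⟨ρ, hρ, hg.comp ?_ ?_⟩
  · have : Differentiable ℂ fun c : ℂ => torusRot t (Function.update z i (c * z i)) := by
      rw [differentiable_pi]
      intro j
      by_cases h : j = i
      · subst h; simp only [torusRot, Function.update_self]; fun_prop
      · simp only [torusRot, Function.update_of_ne h]; fun_prop
    exact this.differentiableOn
  · intro c hc
    rw [mem_ball_zero_iff] at hc
    refine hR _ hρz _ fun j => ?_
    rw [norm_torusRot_apply]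
    have h2 : ‖((ρ : ℂ) • z) j‖ = ρ * ‖z j‖ := by
      simp [abs_of_pos (zero_lt_one.trans hρ)]
    rw [h2]
    by_cases h : j = i
    · subst h
      simp only [Function.update_self, norm_mul]
      gcongr
    · simp only [Function.update_of_ne h]
      exact le_mul_of_one_le_left (norm_nonneg _) hρ.le

theorem torusCoeff_update (hR : IsCompleteReinhardt D) (hD : IsOpen D)
    (hg : DifferentiableOn ℂ g D) {z : Fin n → ℂ} (hz : z ∈ D) (i : Fin n) {c : ℂ} (hc : ‖c‖ ≤ 1)
    (α : Fin n → ℕ) :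
    torusCoeff g (fun j => (α j : ℤ)) (Function.update z i (c * z i)) =
      c ^ α i * torusCoeff g (fun j => (α j : ℤ)) z := by
  -- The integral on the right is free of `c`; the case c = 1 identifies it with the coefficient at
  -- `z`.
  have key : ∀ c : ℂ, ‖c‖ ≤ 1 → torusCoeff g (fun j => (α j : ℤ)) (Function.update z i (c * z i)) =
      c ^ α i * ∫ t, UnitAddTorus.mFourier (-fun j => (α j : ℤ)) t *
        fourierCoeff (fun s : UnitAddCircle =>
          g (torusRot t (Function.update z i (fourier 1 s * 1 * z i)))) (α i) ∂(torusHaar n) := by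
    intro c hc
    rw [torusCoeff_update_eq_integral hR hg.continuousOn hz i hc, ← integral_const_mul]
    congr 1; ext t
    obtain ⟨R, h1, h2⟩ := exists_holomorphic_update hR hD hg hz i t
    obtain ⟨a, ha⟩ := fourierCoeff_holomorphic_dilate h1 h2
    rw [(ha c hc).1 (α i), (ha 1 (by simp)).1 (α i)]
    ring
  have h1 := key 1 (by simp)
  rw [one_mul, Function.update_eq_self, one_pow, one_mul] at h1
  rw [key c hc, h1]

theorem torusCoeff_eq_zero_of_neg (hR : IsCompleteReinhardt D) (hD : IsOpen D)
    (hg : DifferentiableOn ℂ g D) {z : Fin n → ℂ} (hz : z ∈ D) {i : Fin n}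
    {k : Fin n → ℤ} (hk : k i < 0) : torusCoeff g k z = 0 := by
  have h := torusCoeff_update_eq_integral hR hg.continuousOn hz i (c := 1) (by simp) k
  rw [one_mul, Function.update_eq_self] at h
  rw [h]
  refine integral_eq_zero_of_ae (Filter.Eventually.of_forall fun t => ?_)
  obtain ⟨R, h1, h2⟩ := exists_holomorphic_update hR hD hg hz i t
  obtain ⟨a, ha⟩ := fourierCoeff_holomorphic_dilate h1 h2
  simp only [Pi.zero_apply]
  rw [(ha 1 (by simp)).2 (k i) hk, mul_zero]

theorem torusCoeff_mul (hR : IsCompleteReinhardt D) (hD : IsOpen D)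
    (hg : DifferentiableOn ℂ g D) {z : Fin n → ℂ} (hz : z ∈ D) {c : Fin n → ℂ}
    (hc : ∀ i, ‖c i‖ ≤ 1) (α : Fin n → ℕ) :
    torusCoeff g (fun j => (α j : ℤ)) (c * z) =
      (∏ i, c i ^ α i) * torusCoeff g (fun j => (α j : ℤ)) z := by
  have key : ∀ s : Finset (Fin n), torusCoeff g (fun j => (α j : ℤ))
      (fun i => if i ∈ s then c i * z i else z i) =
        (∏ i ∈ s, c i ^ α i) * torusCoeff g (fun j => (α j : ℤ)) z := by
    intro s
    induction s using Finset.induction_on with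
    | empty => simp
    | insert i s hi ih =>
      rw [Finset.prod_insert hi, mul_assoc, ← ih, ← torusCoeff_update hR hD hg _ i (hc i)]
      · congr 1
        ext j
        by_cases h : j = i
        · subst h; simp [hi]
        · simp [h]
      · refine hR z hz _ fun j => ?_
        split_ifs
        · rw [norm_mul]; exact mul_le_of_le_one_left (norm_nonneg _) (hc j)
        · exact le_rfl
  have := key Finset.univ
  simpa using! this

/-- On a complete Reinhardt domain the homogeneous components are monomials. -/
theorem exists_torusCoeff_eq_monomial (hR : IsCompleteReinhardt D) (hD : IsOpen D)
    (h0 : (0 : Fin n → ℂ) ∈ D) (hg : DifferentiableOn ℂ g D) (α : Fin n → ℕ) :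
    ∃ a : ℂ, ∀ z ∈ D, torusCoeff g (fun j => (α j : ℤ)) z = a * ∏ i, z i ^ α i := by
  obtain ⟨ε, hε, hball⟩ := Metric.isOpen_iff.mp hD 0 h0
  set δ : ℝ := ε / 2
  have hδ : 0 < δ := by positivity
  set u : Fin n → ℂ := fun _ => (δ : ℂ)
  have hu : u ∈ D := hball (by
    rw [mem_ball_zero_iff, pi_norm_lt_iff hε]
    intro i
    simp only [u, Complex.norm_real, Real.norm_eq_abs, abs_of_pos hδ]
    exact half_lt_self hε)
  have hδ' : (δ : ℂ) ≠ 0 := by exact_mod_cast hδ.ne'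
  -- The constant is forced by evaluating at `u` = (δ, …, δ), where the monomial is the product of
  -- the powers of δ.
  refine ⟨torusCoeff g (fun j => (α j : ℤ)) u * ∏ i, ((δ : ℂ)⁻¹) ^ α i, fun z hz => ?_⟩
  -- With this scale `r • z` lies in the closed polydisc spanned by `u`, so homogeneity can be
  -- applied to it both from `z` and from `u`; no coordinate of `z` need be nonzero.
  set r : ℝ := min 1 (δ / (‖z‖ + 1))
  have hr : 0 < r := lt_min one_pos (by positivity)
  have hr' : (r : ℂ) ≠ 0 := by exact_mod_cast hr.ne'
  have h1 := torusCoeff_mul hR hD hg hz (c := fun _ => (r : ℂ)) (fun i => by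
    rw [Complex.norm_real, Real.norm_eq_abs, abs_of_pos hr]; exact min_le_left _ _) α
  have h2 := torusCoeff_mul hR hD hg hu (c := fun i => (r : ℂ) * z i / δ) (fun i => by
    rw [norm_div, norm_mul, Complex.norm_real, Complex.norm_real, Real.norm_eq_abs,
      Real.norm_eq_abs, abs_of_pos hr, abs_of_pos hδ, div_le_one hδ]
    calc r * ‖z i‖ ≤ δ / (‖z‖ + 1) * (‖z‖ + 1) := by
          gcongr
          · exact min_le_right _ _
          · exact (norm_le_pi_norm z i).trans (by linarith)
      _ = δ := by field_simp) α
  have h3 : (fun i => (r : ℂ) * z i / δ) * u = (fun _ => (r : ℂ)) * z := by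
    ext i; simp only [Pi.mul_apply, u]; field_simp
  rw [h3, h1] at h2
  have h4 : (∏ i, (r : ℂ) ^ α i) ≠ 0 := Finset.prod_ne_zero_iff.mpr fun i _ => pow_ne_zero _ hr'
  apply mul_left_cancel₀ h4
  rw [h2]
  simp only [div_eq_mul_inv, mul_pow, Finset.prod_mul_distrib]
  ring

theorem summable_prod_pow (n : ℕ) {r : ℝ} (h0 : 0 ≤ r) (h1 : r < 1) :
    Summable fun α : Fin n → ℕ => ∏ i, r ^ α i := by
  induction n with
  | zero => exact Summable.of_finite
  | succ n ih =>
    rw [← (Fin.consEquiv fun _ => ℕ).summable_iff]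
    convert! (summable_geometric_of_lt_one h0 h1).mul_of_nonneg ih
      (fun _ => by positivity) (fun _ => Finset.prod_nonneg fun _ _ => by positivity) using 2 with p
    simp [Fin.prod_univ_succ, Fin.consEquiv]

/-- The Taylor expansion of a holomorphic function on a complete Reinhardt domain. -/
theorem hasSum_torusCoeff (hR : IsCompleteReinhardt D) (hD : IsOpen D)
    (hg : DifferentiableOn ℂ g D) {z : Fin n → ℂ} (hz : z ∈ D) :
    HasSum (fun α : Fin n → ℕ => torusCoeff g (fun j => (α j : ℤ)) z) (g z) := by
  have hinj : Function.Injective fun (α : Fin n → ℕ) (j : Fin n) => (α j : ℤ) := fun a b h => by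
    ext j; exact Int.ofNat_inj.mp (congrFun h j)
  have hvan : ∀ k ∉ Set.range fun (α : Fin n → ℕ) (j : Fin n) => (α j : ℤ),
      torusCoeff g k z = 0 := by
    intro k hk
    have : ∃ i, k i < 0 := by
      by_contra! h
      exact hk ⟨fun j => (k j).toNat, by ext j; simp [h j]⟩
    obtain ⟨i, hi⟩ := this
    exact torusCoeff_eq_zero_of_neg hR hD hg hz hi
  -- On the compact orbit of `ρ • z` the function is bounded by some M; contracting back to `z`
  -- bounds the term of degree α by M ρ^(-|α|), which is summable.
  obtain ⟨ρ, hρ, hρz⟩ := IsCompleteReinhardt.exists_one_lt_smul_mem hD hz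
  have hρ0 : 0 < ρ := zero_lt_one.trans hρ
  have hsum : Summable fun α : Fin n → ℕ => torusCoeff g (fun j => (α j : ℤ)) z := by
    obtain ⟨M, hM⟩ := (isCompact_range
      (continuous_comp_torusRot hR hg.continuousOn hρz)).isBounded.exists_norm_le
    refine Summable.of_norm_bounded ((summable_prod_pow n (inv_nonneg.mpr hρ0.le)
      (inv_lt_one_of_one_lt₀ hρ)).mul_right M) fun α => ?_
    have h1 := torusCoeff_mul hR hD hg hρz (c := fun _ => ((ρ⁻¹ : ℝ) : ℂ)) (fun i => by
      rw [Complex.norm_real, Real.norm_eq_abs, abs_of_pos (inv_pos.mpr hρ0)]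
      exact (inv_lt_one_of_one_lt₀ hρ).le) α
    have h2 : (fun _ => ((ρ⁻¹ : ℝ) : ℂ)) * ((ρ : ℂ) • z) = z := by
      ext i
      have : (ρ : ℂ) ≠ 0 := by exact_mod_cast hρ0.ne'
      simp [this]
    rw [h2] at h1
    rw [h1, norm_mul, norm_prod]
    simp only [norm_pow, Complex.norm_real, Real.norm_eq_abs, abs_of_pos (inv_pos.mpr hρ0)]
    gcongr
    exact norm_torusCoeff_le (fun t => hM _ ⟨t, rfl⟩) _
  refine (hinj.hasSum_iff (f := fun k => torusCoeff g k z) hvan).mpr ?_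
  have hs : Summable fun k => torusCoeff g k z := (hinj.summable_iff hvan).mp hsum
  have := UnitAddTorus.hasSum_mFourier_series_apply_of_summable
    (f := ⟨_, continuous_comp_torusRot hR hg.continuousOn hz⟩) hs 0
  simp only [ContinuousMap.coe_mk, torusRot_zero] at this
  convert! this using 2 with k
  simp [torusCoeff, UnitAddTorus.mFourier]

end

/-! ### Orthogonality of the monomials. -/

section

variable {n : ℕ} {D : Set (Fin n → ℂ)} {g : (Fin n → ℂ) → ℂ}

theorem measurePreserving_torusRot (t : UnitAddTorus (Fin n)) :
    MeasurePreserving (torusRot t) volume volume := by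
  refine measurePreserving_pi (fun _ => volume) (fun _ => volume)
    (f := fun i x => fourier 1 (t i) * x) fun i => ?_
  have := (rotation (AddCircle.toCircle (t i))).measurePreserving
  convert! this using 1
  ext x
  simp

theorem measurePreserving_torusRot_restrict (hR : IsCompleteReinhardt D) (hD : MeasurableSet D)
    (t : UnitAddTorus (Fin n)) :
    MeasurePreserving (torusRot t) (volume.restrict D) (volume.restrict D) := by
  have := (measurePreserving_torusRot t).restrict_preimage hD
  rwa [show torusRot t ⁻¹' D = D from Set.ext fun z => hR.torusRot_mem_iff t] at this

/-- The monomial function `z ↦ z ^ α`. -/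
def monomialFun (α : Fin n → ℕ) (z : Fin n → ℂ) : ℂ := ∏ i, z i ^ α i

theorem differentiable_monomialFun (α : Fin n → ℕ) : Differentiable ℂ (monomialFun α) := by
  unfold monomialFun; fun_prop

theorem monomialFun_torusRot (α : Fin n → ℕ) (t : UnitAddTorus (Fin n)) (z : Fin n → ℂ) :
    monomialFun α (torusRot t z) =
      UnitAddTorus.mFourier (fun j => (α j : ℤ)) t * monomialFun α z := by
  simp only [monomialFun, torusRot, mul_pow, Finset.prod_mul_distrib, UnitAddTorus.mFourier,
    ContinuousMap.coe_mk]
  congr 1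
  refine Finset.prod_congr rfl fun i _ => ?_
  rw [fourier_eq_zpow (α i : ℤ), zpow_natCast]

theorem conj_mFourier_mul_self (k : Fin n → ℤ) (t : UnitAddTorus (Fin n)) :
    conj (UnitAddTorus.mFourier k t) = UnitAddTorus.mFourier (-k) t :=
  UnitAddTorus.mFourier_neg.symm

/-- Integration against a monomial only sees the homogeneous component of its degree. -/
theorem setIntegral_conj_monomialFun_mul (hR : IsCompleteReinhardt D) (hD : MeasurableSet D)
    (α : Fin n → ℕ) (hint : IntegrableOn (fun z => conj (monomialFun α z) * g z) D) :
    ∫ z in D, conj (monomialFun α z) * g z =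
      ∫ z in D, conj (monomialFun α z) * torusCoeff g (fun j => (α j : ℤ)) z := by
  set h : (Fin n → ℂ) → ℂ := fun z => conj (monomialFun α z) * g z
  have hrot : ∀ t z, h (torusRot t z) = conj (monomialFun α z) *
      (UnitAddTorus.mFourier (-fun j => (α j : ℤ)) t * g (torusRot t z)) := by
    intro t z
    simp only [h, monomialFun_torusRot, map_mul, conj_mFourier_mul_self]
    ring
  -- The shear (t, z) ↦ (t, t·z) preserves the product measure, so integrability of `h` on D passes
  -- to the product and Fubini applies below.
  have hsk : MeasurePreserving (fun p : UnitAddTorus (Fin n) × (Fin n → ℂ) =>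
      (p.1, torusRot p.1 p.2)) ((torusHaar n).prod (volume.restrict D))
      ((torusHaar n).prod (volume.restrict D)) :=
    (MeasurePreserving.id _).skew_product continuous_torusRot.measurable
      (Filter.Eventually.of_forall fun t => (measurePreserving_torusRot_restrict hR hD t).map_eq)
  have hint2 : Integrable (fun p : UnitAddTorus (Fin n) × (Fin n → ℂ) => h (torusRot p.1 p.2))
      ((torusHaar n).prod (volume.restrict D)) :=
    hsk.integrable_comp_of_integrable (Integrable.comp_snd hint (torusHaar n))
  have hinv : ∀ t, ∫ z in D, h (torusRot t z) = ∫ z in D, h z := by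
    intro t
    have hmp := measurePreserving_torusRot_restrict hR hD t
    have := integral_map (μ := volume.restrict D) (φ := torusRot t) (f := h)
      hmp.measurable.aemeasurable (by rw [hmp.map_eq]; exact hint.1)
    rw [← this, hmp.map_eq]
  calc ∫ z in D, h z = ∫ t, (∫ z in D, h (torusRot t z)) ∂(torusHaar n) := by
        simp only [hinv, integral_const, probReal_univ, one_smul]
    _ = ∫ z in D, ∫ t, h (torusRot t z) ∂(torusHaar n) := integral_integral_swap hint2
    _ = _ := by
        congr 1; ext z
        simp only [hrot]
        rw [integral_const_mul, torusCoeff, mFourierCoeff_eq_integral_pi]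

theorem torusCoeff_monomialFun (α β : Fin n → ℕ) (z : Fin n → ℂ) (h : α ≠ β) :
    torusCoeff (monomialFun β) (fun j => (α j : ℤ)) z = 0 := by
  obtain ⟨i, hi⟩ := Function.ne_iff.mp h
  have hi' : ((α i : ℤ) : ℤ) ≠ β i := by exact_mod_cast hi
  rw [torusCoeff, mFourierCoeff_eq_integral_pi]
  simp only [monomialFun_torusRot, ← mul_assoc, ← UnitAddTorus.mFourier_add]
  rw [integral_mul_const]
  simp only [UnitAddTorus.mFourier, ContinuousMap.coe_mk]
  rw [integral_fintype_prod_eq_prod (𝕜 := ℂ)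
    (E := fun _ => UnitAddCircle) (μ := fun _ => AddCircle.haarAddCircle)
    (f := fun i t => fourier (((-fun j => (α j : ℤ)) + fun j => (β j : ℤ)) i) t),
    Finset.prod_eq_zero (Finset.mem_univ i), zero_mul]
  have : Fact ((0 : ℝ) < 1) := ⟨one_pos⟩
  have h1 := congrFun (fourierCoeff_fourier (T := 1) (β i : ℤ)) (α i : ℤ)
  rw [Pi.single_eq_of_ne hi', fourierCoeff] at h1
  rw [← h1]
  congr 1; ext t
  simp

/-- For a holomorphic function on a complete Reinhardt domain the term of degree `α` of the
Taylor series is the orthogonal projection to the monomial of that degree. -/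
theorem integral_conj_monomialFun_mul_monomialFun (hR : IsCompleteReinhardt D) (hD : IsOpen D)
    (h0 : (0 : Fin n → ℂ) ∈ D) (hg : DifferentiableOn ℂ g D) (α : Fin n → ℕ)
    (hint : IntegrableOn (fun z => conj (monomialFun α z) * g z) D) {w : Fin n → ℂ} (hw : w ∈ D) :
    (∫ z in D, conj (monomialFun α z) * g z) * monomialFun α w =
      ((∫ z in D, ‖monomialFun α z‖ ^ 2 : ℝ) : ℂ) * torusCoeff g (fun j => (α j : ℤ)) w := by
  obtain ⟨a, ha⟩ := exists_torusCoeff_eq_monomial hR hD h0 hg α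
  rw [setIntegral_conj_monomialFun_mul hR hD.measurableSet α hint, ha w hw]
  have : ∫ z in D, conj (monomialFun α z) * torusCoeff g (fun j => (α j : ℤ)) z =
      a * ((∫ z in D, ‖monomialFun α z‖ ^ 2 : ℝ) : ℂ) := by
    rw [← integral_complex_ofReal, ← integral_const_mul]
    refine setIntegral_congr_fun hD.measurableSet fun z hz => ?_
    rw [ha z hz, mul_left_comm]
    change a * (conj (monomialFun α z) * monomialFun α z) = _
    rw [← Complex.normSq_eq_conj_mul_self, Complex.normSq_eq_norm_sq]
  rw [this]
  change _ = _ * (a * monomialFun α w)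
  ring

end

/-! ### Orthonormal bases and the reproducing property. -/

section

/-- Parseval's identity for an orthonormal family, for vectors in its closed span. -/
theorem Orthonormal.hasSum_inner_mul_inner_of_mem {E ι : Type*} [NormedAddCommGroup E]
    [InnerProductSpace ℂ E] [CompleteSpace E] {v : ι → E} (hv : Orthonormal ℂ v) {x y : E}
    (hx : x ∈ (Submodule.span ℂ (Set.range v)).topologicalClosure)
    (hy : y ∈ (Submodule.span ℂ (Set.range v)).topologicalClosure) :
    HasSum (fun i => inner ℂ x (v i) * inner ℂ (v i) y) (inner ℂ x y) := by
  set S := (Submodule.span ℂ (Set.range v)).topologicalClosure with hS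
  have : CompleteSpace S := (Submodule.isClosed_topologicalClosure _).completeSpace_coe
  have hmem : ∀ i, v i ∈ S := fun i =>
    Submodule.le_topologicalClosure _ (Submodule.subset_span ⟨i, rfl⟩)
  let u : ι → S := fun i => ⟨v i, hmem i⟩
  have hu : Orthonormal ℂ u := ⟨fun i => hv.1 i, fun i j hij => hv.2 hij⟩
  -- A vector of S orthogonal to all `v i` is orthogonal to their closed span S, hence to itself.
  have hbot : (Submodule.span ℂ (Set.range u))ᗮ = ⊥ := by
    rw [Submodule.eq_bot_iff]
    intro a ha
    have h1 : (a : E) ∈ (Submodule.span ℂ (Set.range v))ᗮ := by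
      rw [Submodule.mem_orthogonal]
      intro b hb
      induction hb using Submodule.span_induction with
      | mem b hb =>
        obtain ⟨i, rfl⟩ := hb
        exact (Submodule.mem_orthogonal _ _).mp ha (u i) (Submodule.subset_span ⟨i, rfl⟩)
      | zero => simp
      | add b c _ _ hb hc => rw [inner_add_left, hb, hc, add_zero]
      | smul c b _ hb => rw [inner_smul_left, hb, mul_zero]
    rw [← Submodule.orthogonal_closure] at h1
    have h2 : inner ℂ (a : E) (a : E) = 0 := (Submodule.mem_orthogonal _ _).mp h1 a a.2
    exact Subtype.ext (inner_self_eq_zero.mp h2)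
  have := (HilbertBasis.mkOfOrthogonalEqBot hu hbot).hasSum_inner_mul_inner ⟨x, hx⟩ ⟨y, hy⟩
  simpa [HilbertBasis.coe_mkOfOrthogonalEqBot] using! this

variable {n : ℕ} {D : Set (Fin n → ℂ)}

/-- A countable orthonormal family of holomorphic functions such that every function in the
Bergman space is the pointwise sum of its Fourier series is a complete orthonormal basis. -/
theorem isBergmanBasis_of_hasSum {ι : Type} [Countable ι] {e : ι → (Fin n → ℂ) → ℂ}
    (hD : MeasurableSet D) (he : ∀ j, DifferentiableOn ℂ (e j) D)
    (hm : ∀ j, MemLp (e j) 2 (volume.restrict D))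
    (ho : Orthonormal ℂ (fun j => (hm j).toLp (e j)))
    (hexp : ∀ g, DifferentiableOn ℂ g D → ∀ hg : MemLp g 2 (volume.restrict D), ∀ w ∈ D,
      HasSum (fun j => inner ℂ ((hm j).toLp (e j)) (hg.toLp g) * e j w) (g w)) :
    IsBergmanBasis D e := by
  refine ⟨he, hm, ho, ?_⟩
  rintro f ⟨g, hg, hfg⟩
  have hgm : MemLp g 2 (volume.restrict D) := (memLp_congr_ae hfg).mp (Lp.memLp f)
  have hf : f = hgm.toLp g := Lp.ext (hfg.trans (MemLp.coeFn_toLp hgm).symm)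
  set E := fun j => (hm j).toLp (e j)
  -- Bessel's inequality makes the Fourier series converge in L².
  have hsum : Summable fun j => inner ℂ (E j) f • E j := by
    have := (ho.orthogonalFamily.summable_iff_norm_sq_summable
      (fun j => inner ℂ (E j) f)).mpr (ho.inner_products_summable f)
    simpa using this
  obtain ⟨h, hh⟩ := hsum
  have hmem : h ∈ (Submodule.span ℂ (Set.range E)).topologicalClosure := by
    refine mem_closure_of_tendsto hh (Filter.Eventually.of_forall fun s => ?_)
    exact Submodule.sum_mem _ fun j _ => Submodule.smul_mem _ _ (Submodule.subset_span ⟨j, rfl⟩)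
  suffices f = h by rwa [this]
  -- A subsequence of the L²-convergent partial sums converges almost everywhere to `h`, while the
  -- pointwise expansion makes it converge to `g`; hence the two limits agree.
  obtain ⟨ns, hns, hae⟩ := (tendstoInMeasure_of_tendsto_Lp hh).exists_seq_tendsto_ae'
  have hE : ∀ᵐ x ∂(volume.restrict D), ∀ j, E j x = e j x :=
    ae_all_iff.mpr fun j => MemLp.coeFn_toLp (hm j)
  have hsm : ∀ᵐ x ∂(volume.restrict D), ∀ j, (inner ℂ (E j) f • E j : Lp ℂ 2 _) x =
      inner ℂ (E j) f • E j x := ae_all_iff.mpr fun j => Lp.coeFn_smul _ _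
  have hfs : ∀ᵐ x ∂(volume.restrict D), ∀ i, (∑ j ∈ ns i, inner ℂ (E j) f • E j : Lp ℂ 2 _) x =
      ∑ j ∈ ns i, (inner ℂ (E j) f • E j : Lp ℂ 2 _) x := by
    refine ae_all_iff.mpr fun i => ?_
    filter_upwards [Lp.coeFn_finsetSum (ns i) (fun j => inner ℂ (E j) f • E j)] with x hx
    rw [hx, Finset.sum_apply]
  refine Lp.ext ?_
  filter_upwards [hae, hE, hsm, hfs, hfg, ae_restrict_mem hD] with x h1 h2 h3 h4 h5 h6
  rw [h5]
  refine tendsto_nhds_unique ?_ h1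
  have h7 := (hexp g hg hgm x h6).comp hns
  refine h7.congr fun i => ?_
  simp only [Function.comp_apply]
  rw [h4]
  refine Finset.sum_congr rfl fun j _ => ?_
  rw [h3, h2, smul_eq_mul, hf]

/-- If the Bergman space has a countable orthonormal family with pointwise convergent expansions
and square summable point evaluations, the Bergman kernel is given by the sum over this family. -/
theorem exists_isBergmanKernel_hasSum {ι : Type} [Countable ι] {e : ι → (Fin n → ℂ) → ℂ}
    (hD : MeasurableSet D) (he : ∀ j, DifferentiableOn ℂ (e j) D)
    (hm : ∀ j, MemLp (e j) 2 (volume.restrict D))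
    (ho : Orthonormal ℂ (fun j => (hm j).toLp (e j)))
    (hexp : ∀ g, DifferentiableOn ℂ g D → ∀ hg : MemLp g 2 (volume.restrict D), ∀ w ∈ D,
      HasSum (fun j => inner ℂ ((hm j).toLp (e j)) (hg.toLp g) * e j w) (g w))
    (hsq : ∀ w ∈ D, Summable fun j => ‖e j w‖ ^ 2) :
    ∃ K, IsBergmanKernel D K ∧
      ∀ z ∈ D, ∀ w ∈ D, HasSum (fun j => e j z * conj (e j w)) (K z w) := by
  have hbasis := isBergmanBasis_of_hasSum hD he hm ho hexp
  set E := fun j => (hm j).toLp (e j)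
  have hk : ∀ w ∈ D, Summable fun j => conj (e j w) • E j := by
    intro w hw
    have := (ho.orthogonalFamily.summable_iff_norm_sq_summable
      (fun j => conj (e j w))).mpr (by simpa using hsq w hw)
    simpa using this
  -- `k w` is the Riesz representer of evaluation at `w`; `hsq` makes its series converge.
  set k : (Fin n → ℂ) → Lp ℂ 2 (volume.restrict D) := fun w => ∑' j, conj (e j w) • E j
  have hrep : ∀ g, DifferentiableOn ℂ g D → ∀ hg : MemLp g 2 (volume.restrict D), ∀ w ∈ D,
      inner ℂ (k w) (hg.toLp g) = g w := by
    intro g hg hgm w hw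
    refine HasSum.unique ?_ (hexp g hg hgm w hw)
    have h1 := (hk w hw).hasSum.mapL (innerSL ℂ (hgm.toLp g))
    have h2 := h1.map (starRingEnd ℂ) Complex.continuous_conj
    convert! h2 using 1
    · ext j
      simp only [Function.comp_apply, map_smul, innerSL_apply_apply, smul_eq_mul, map_mul,
        Complex.conj_conj, inner_conj_symm]
      exact mul_comm _ _
    · exact (inner_conj_symm _ _).symm
  have hEmem : ∀ j, E j ∈ bergmanSpace D := fun j => ⟨e j, he j, MemLp.coeFn_toLp (hm j)⟩
  -- Independence of the basis: ⟨k z, φⱼ⟩ = φⱼ(z) and ⟨φⱼ, k w⟩ is the conjugate of φⱼ(w), so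
  -- Parseval gives the same sum ⟨k z, k w⟩ for every basis.
  have hall : ∀ (κ : Type) (φ : κ → (Fin n → ℂ) → ℂ), IsBergmanBasis D φ →
      ∀ z ∈ D, ∀ w ∈ D, HasSum (fun j => φ j z * conj (φ j w)) (inner ℂ (k z) (k w)) := by
    intro κ φ hφ z hz w hw
    have hkmem : ∀ w ∈ D, k w ∈
        (Submodule.span ℂ (Set.range fun j => (hφ.memLp j).toLp (φ j))).topologicalClosure := by
      intro w hw
      refine (Submodule.isClosed_topologicalClosure _).mem_of_tendsto (hk w hw).hasSum
        (Filter.Eventually.of_forall fun s => ?_)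
      exact Submodule.sum_mem _ fun j _ => Submodule.smul_mem _ _ (hφ.complete (hEmem j))
    have := hφ.orthonormal.hasSum_inner_mul_inner_of_mem (hkmem z hz) (hkmem w hw)
    convert! this using 2 with j
    rw [hrep _ (hφ.holomorphic j) (hφ.memLp j) z hz, ← inner_conj_symm,
      hrep _ (hφ.holomorphic j) (hφ.memLp j) w hw]
  exact ⟨fun z w => inner ℂ (k z) (k w), ⟨⟨ι, e, hbasis⟩, hall⟩, hall ι e hbasis⟩

end

/-! ### The kernel of a complete Reinhardt domain as a monomial series. -/

section

variable {n : ℕ} {D : Set (Fin n → ℂ)} {g : (Fin n → ℂ) → ℂ}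

theorem inner_toLp_eq_setIntegral {f g : (Fin n → ℂ) → ℂ} (hf : MemLp f 2 (volume.restrict D))
    (hg : MemLp g 2 (volume.restrict D)) :
    inner ℂ (hf.toLp f) (hg.toLp g) = ∫ z in D, conj (f z) * g z := by
  rw [L2.inner_def]
  refine integral_congr_ae ?_
  filter_upwards [hf.coeFn_toLp, hg.coeFn_toLp] with z h1 h2
  rw [h1, h2, RCLike.inner_apply, mul_comm]

theorem integrable_conj_mul {f g : (Fin n → ℂ) → ℂ} (hf : MemLp f 2 (volume.restrict D))
    (hg : MemLp g 2 (volume.restrict D)) : IntegrableOn (fun z => conj (f z) * g z) D :=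
  MemLp.integrable_mul (p := 2) (q := 2) hf.star hg

/-- The Bergman kernel of a complete Reinhardt domain is the sum of the normalised monomials. -/
theorem IsCompleteReinhardt.exists_isBergmanKernel_hasSum (hR : IsCompleteReinhardt D)
    (hD : IsOpen D) (h0 : (0 : Fin n → ℂ) ∈ D)
    (hm : ∀ α : Fin n → ℕ, MemLp (monomialFun α) 2 (volume.restrict D))
    (hpos : ∀ α : Fin n → ℕ, 0 < ∫ z in D, ‖monomialFun α z‖ ^ 2)
    (hsq : ∀ w ∈ D, Summable fun α : Fin n → ℕ =>
      ‖monomialFun α w‖ ^ 2 / ∫ z in D, ‖monomialFun α z‖ ^ 2) :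
    ∃ K, IsBergmanKernel D K ∧ ∀ z ∈ D, ∀ w ∈ D,
      HasSum (fun α : Fin n → ℕ => monomialFun α z * conj (monomialFun α w) /
        ((∫ z in D, ‖monomialFun α z‖ ^ 2 : ℝ) : ℂ)) (K z w) := by
  set N : (Fin n → ℕ) → ℝ := fun α => ∫ z in D, ‖monomialFun α z‖ ^ 2
  set ν : (Fin n → ℕ) → ℝ := fun α => (√(N α))⁻¹
  have hν : ∀ α, (ν α : ℂ) * ν α = (N α : ℂ)⁻¹ := by
    intro α
    rw [← Complex.ofReal_mul, ← Complex.ofReal_inv, ← mul_inv, Real.mul_self_sqrt (hpos α).le]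
  have hN : ∀ α, (N α : ℂ) ≠ 0 := fun α => by exact_mod_cast (hpos α).ne'
  set e : (Fin n → ℕ) → (Fin n → ℂ) → ℂ := fun α z => ν α * monomialFun α z
  have hed : ∀ α, DifferentiableOn ℂ (e α) D := fun α =>
    ((differentiable_monomialFun α).const_mul _).differentiableOn
  have hem : ∀ α, MemLp (e α) 2 (volume.restrict D) := fun α => (hm α).const_mul _
  have hinner : ∀ α (g : (Fin n → ℂ) → ℂ) (hg : MemLp g 2 (volume.restrict D)),
      inner ℂ ((hem α).toLp (e α)) (hg.toLp g) =
        ν α * ∫ z in D, conj (monomialFun α z) * g z := by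
    intro α g hg
    rw [inner_toLp_eq_setIntegral, ← integral_const_mul]
    congr 1; ext z
    simp only [e, map_mul, Complex.conj_ofReal]; ring
  have hself : ∀ α, ∫ z in D, conj (monomialFun α z) * monomialFun α z = (N α : ℂ) := by
    intro α
    rw [← integral_complex_ofReal]
    congr 1; ext z
    rw [← Complex.normSq_eq_conj_mul_self, Complex.normSq_eq_norm_sq]
  have ho : Orthonormal ℂ fun α => (hem α).toLp (e α) := by
    classical
    rw [orthonormal_iff_ite]
    intro α β
    rw [hinner]
    have h1 : ∫ z in D, conj (monomialFun α z) * e β z =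
        ν β * ∫ z in D, conj (monomialFun α z) * monomialFun β z := by
      rw [← integral_const_mul]; congr 1; ext z; simp only [e]; ring
    rw [h1]
    split_ifs with h
    · subst h
      rw [hself, ← mul_assoc, hν, inv_mul_cancel₀ (hN α)]
    · rw [setIntegral_conj_monomialFun_mul hR hD.measurableSet α
        (integrable_conj_mul (hm α) (hm β))]
      simp [torusCoeff_monomialFun α β _ h]
  have hexp : ∀ g, DifferentiableOn ℂ g D → ∀ hg : MemLp g 2 (volume.restrict D), ∀ w ∈ D,
      HasSum (fun α => inner ℂ ((hem α).toLp (e α)) (hg.toLp g) * e α w) (g w) := by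
    intro g hg hgm w hw
    convert! hasSum_torusCoeff hR hD hg hw using 2 with α
    have h1 := integral_conj_monomialFun_mul_monomialFun hR hD h0 hg α
      (integrable_conj_mul (hm α) hgm) hw
    rw [hinner]
    calc _ = (ν α * ν α : ℂ) * ((∫ z in D, conj (monomialFun α z) * g z) * monomialFun α w) := by
          simp only [e]; ring
      _ = _ := by
          rw [h1, hν, ← mul_assoc]
          exact (congrArg (· * _) (inv_mul_cancel₀ (hN α))).trans (one_mul _)
  obtain ⟨K, hK, hsum⟩ := _root_.exists_isBergmanKernel_hasSum hD.measurableSet hed hem ho hexp (by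
    intro w hw
    convert! hsq w hw using 2 with α
    simp only [e, norm_mul, Complex.norm_real, Real.norm_eq_abs, mul_pow, sq_abs, ν, inv_pow]
    rw [Real.sq_sqrt (hpos α).le, div_eq_inv_mul])
  refine ⟨K, hK, fun z hz w hw => ?_⟩
  convert! hsum z hz w hw using 2 with α
  simp only [e, map_mul, Complex.conj_ofReal]
  rw [div_eq_mul_inv]
  change _ * (N α : ℂ)⁻¹ = _
  rw [← hν]; ring

end

/-! ### Summation of the kernel series and nonvanishing of its closed form. -/

/-- The reciprocal of the Beta integral `∫₀¹ tᵃ (1 - t)ˢ dt`. -/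
noncomputable def betaCoeff (s : ℝ) (a : ℕ) : ℝ :=
  (∏ j ∈ Finset.range (a + 1), (s + 1 + j)) / a.factorial

theorem betaCoeff_pos {s : ℝ} (hs : 0 ≤ s) (a : ℕ) : 0 < betaCoeff s a :=
  div_pos (Finset.prod_pos fun j _ => by positivity) (by positivity)

theorem integral_pow_mul_one_sub_rpow {s : ℝ} (hs : 0 ≤ s) (a : ℕ) :
    ∫ t in (0 : ℝ)..1, t ^ a * (1 - t) ^ s = (betaCoeff s a)⁻¹ := by
  have h := Complex.betaIntegral_eval_nat_add_one_right (u := (s + 1 : ℂ))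
    (by simp; linarith) a
  rw [← Complex.betaIntegral_symm, Complex.betaIntegral] at h
  have h2 : ∫ t in (0 : ℝ)..1, (t : ℂ) ^ ((a + 1 : ℂ) - 1) * (1 - (t : ℂ)) ^ ((s + 1 : ℂ) - 1) =
      ((∫ t in (0 : ℝ)..1, t ^ a * (1 - t) ^ s : ℝ) : ℂ) := by
    rw [← intervalIntegral.integral_ofReal]
    refine intervalIntegral.integral_congr fun t ht => ?_
    rw [Set.uIcc_of_le zero_le_one] at ht
    simp only [add_sub_cancel_right, Complex.cpow_natCast]
    rw [Complex.ofReal_mul, Complex.ofReal_cpow (by linarith [ht.2])]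
    push_cast; rfl
  rw [h2] at h
  apply Complex.ofReal_injective
  rw [h, betaCoeff]
  push_cast
  rw [inv_div]

theorem smeval_ascPochhammer_eq_prod {𝕂 : Type*} [Field 𝕂] (r : 𝕂) (a : ℕ) :
    (ascPochhammer ℕ a).smeval r = ∏ j ∈ Finset.range a, (r + j) := by
  rw [Polynomial.ascPochhammer_smeval_eq_eval]
  induction a with
  | zero => simp
  | succ a ih => rw [ascPochhammer_succ_eval, ih, Finset.prod_range_succ]

/-- Splitting off the factor s+1 leaves the rising factorial of s+2, so `betaCoeff` is s+1 times a
coefficient of the binomial series of (1-x)^(-s-2). -/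
theorem prod_div_factorial_eq_choose {𝕂 : Type*} [Field 𝕂] [CharZero 𝕂] [BinomialRing 𝕂]
    (s : 𝕂) (a : ℕ) :
    (∏ j ∈ Finset.range (a + 1), (s + 1 + j)) / a.factorial =
      (s + 1) * Ring.choose (s + 2 + a - 1) a := by
  have h := Ring.factorial_nsmul_multichoose_eq_ascPochhammer (s + 2) a
  rw [smeval_ascPochhammer_eq_prod, Ring.multichoose_eq, nsmul_eq_mul] at h
  rw [Finset.prod_range_succ', div_eq_iff (by exact_mod_cast a.factorial_ne_zero), mul_assoc,
    mul_comm (Ring.choose _ _), h, mul_comm]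
  congr 1
  · simp
  · refine Finset.prod_congr rfl fun j _ => ?_
    push_cast; ring

theorem hasSum_betaCoeff_mul_pow (s : ℝ) {x : ℂ} (hx : ‖x‖ < 1) :
    HasSum (fun a => (betaCoeff s a : ℂ) * x ^ a) ((s + 1) * (1 / (1 - x) ^ (s + 2 : ℂ))) := by
  have h := (Complex.one_div_one_sub_cpow_hasFPowerSeriesOnBall_zero (s + 2)).hasSum (y := x)
    (by
      rw [Metric.mem_eball, edist_zero_right, ← ofReal_norm]
      exact ENNReal.ofReal_lt_one.mpr hx)
  rw [zero_add] at h
  convert! h.mul_left (s + 1 : ℂ) using 2 with a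
  rw [FormalMultilinearSeries.ofScalars_apply_eq, smul_eq_mul, ← mul_assoc,
    ← prod_div_factorial_eq_choose, betaCoeff]
  push_cast; rfl

theorem hasSum_betaCoeff_mul_pow_real (s : ℝ) {x : ℝ} (h0 : 0 ≤ x) (hx : x < 1) :
    HasSum (fun a => betaCoeff s a * x ^ a) ((s + 1) * (1 / (1 - x) ^ (s + 2))) := by
  rw [← Complex.hasSum_ofReal]
  have := hasSum_betaCoeff_mul_pow s (x := (x : ℂ))
    (by rwa [Complex.norm_real, Real.norm_eq_abs, abs_of_nonneg h0])
  convert! this using 2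
  · push_cast; rfl
  · push_cast [Complex.ofReal_cpow (show 0 ≤ 1 - x by linarith)]; rfl

theorem one_sub_ne_zero_of_norm_lt {x : ℂ} (hx : ‖x‖ < 1) : 1 - x ≠ 0 := by
  intro h; rw [← sub_eq_zero.mp h] at hx; simp at hx

theorem hasSum_succ_mul_pow {Y : ℂ} (hY : ‖Y‖ < 1) :
    HasSum (fun b : ℕ => (b + 1 : ℂ) * Y ^ b) (1 / (1 - Y) ^ 2) := by
  have h := hasSum_choose_mul_geometric_of_norm_lt_one 1 hY
  simpa using h

/-- Uses (b+1)² = 2·C(b+2, 2) - (b+1). -/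
theorem hasSum_succ_sq_mul_pow {Y : ℂ} (hY : ‖Y‖ < 1) :
    HasSum (fun b : ℕ => (b + 1 : ℂ) ^ 2 * Y ^ b) ((1 + Y) / (1 - Y) ^ 3) := by
  have h1 := (hasSum_choose_mul_geometric_of_norm_lt_one 2 hY).mul_left 2
  have h := h1.sub (hasSum_succ_mul_pow hY)
  have hne := one_sub_ne_zero_of_norm_lt hY
  convert! h using 1
  · ext b
    rw [← mul_assoc, ← sub_mul]
    congr 1
    have : ((b + 2).choose 2 : ℂ) = (b + 2) * (b + 1) / 2 := by
      rw [Nat.cast_choose_two]; push_cast; ring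
    rw [this]; ring
  · field_simp; ring

/-- The value of the double series appearing in the kernel. -/
theorem hasSum_double_series (κ μ : ℝ) {Y W : ℂ} (hY : ‖Y‖ < 1) (hW : ‖W‖ < 1) :
    HasSum (fun p : ℕ × ℕ => (p.1 + 1 : ℂ) * (p.2 + 1) *
      ((κ * (p.1 + 1) + μ * (p.2 + 1) + 1) * (Y ^ p.1 * W ^ p.2)))
      (1 / (1 - Y) ^ 2 * (1 / (1 - W) ^ 2) *
        (κ * ((1 + Y) / (1 - Y)) + μ * ((1 + W) / (1 - W)) + 1)) := by
  have mulSum : ∀ {f g : ℕ → ℂ} {a b : ℂ}, HasSum f a → HasSum g b →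
      HasSum (fun p : ℕ × ℕ => f p.1 * g p.2) (a * b) := fun hf hg =>
    hf.mul hg (summable_mul_of_summable_norm hf.summable.norm hg.summable.norm)
  have h := (((mulSum (hasSum_succ_sq_mul_pow hY) (hasSum_succ_mul_pow hW)).mul_left (κ : ℂ)).add
    ((mulSum (hasSum_succ_mul_pow hY) (hasSum_succ_sq_mul_pow hW)).mul_left (μ : ℂ))).add
    (mulSum (hasSum_succ_mul_pow hY) (hasSum_succ_mul_pow hW))
  convert! h using 1
  · ext p; ring
  · have := one_sub_ne_zero_of_norm_lt hY
    have := one_sub_ne_zero_of_norm_lt hW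
    field_simp

theorem norm_div_one_sub_cpow_lt {x y : ℂ} {κ : ℝ} (hκ : 0 < κ) (hx : ‖x‖ < 1)
    (hy : ‖y‖ < (1 - ‖x‖) ^ κ) : ‖y / (1 - x) ^ (κ : ℂ)‖ < 1 := by
  have h1 : 1 - ‖x‖ ≤ ‖1 - x‖ := by
    have := norm_sub_norm_le (1 : ℂ) x; simpa using this
  have h2 : 0 < ‖1 - x‖ := by linarith
  rw [norm_div, Complex.norm_cpow_real, div_lt_one (by positivity)]
  exact hy.trans_le (Real.rpow_le_rpow (by linarith) h1 hκ.le)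

/-- Needed on the diagonal z = w, where it says that the squares of the normalised monomials are
summable. The terms are nonnegative, so iterated summation suffices. -/
theorem summable_triple_series {κ μ x y w : ℝ} (hκ : 0 < κ) (hμ : 0 < μ) (x0 : 0 ≤ x)
    (y0 : 0 ≤ y) (w0 : 0 ≤ w) (hx : x < 1) (hy : y < (1 - x) ^ κ) (hw : w < (1 - x) ^ μ) :
    Summable fun p : (ℕ × ℕ) × ℕ => (p.1.1 + 1 : ℝ) * (p.1.2 + 1) *
      betaCoeff (κ * (p.1.1 + 1) + μ * (p.1.2 + 1)) p.2 * (x ^ p.2 * y ^ p.1.1 * w ^ p.1.2) := by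
  have hpos : ∀ b c : ℕ, 0 ≤ κ * (b + 1) + μ * (c + 1) := fun b c => by positivity
  have hinner : ∀ b c : ℕ, HasSum (fun a => (b + 1 : ℝ) * (c + 1) *
      betaCoeff (κ * (b + 1) + μ * (c + 1)) a * (x ^ a * y ^ b * w ^ c))
      ((b + 1 : ℝ) * (c + 1) * (y ^ b * w ^ c) * ((κ * (b + 1) + μ * (c + 1) + 1) *
        (1 / (1 - x) ^ (κ * (b + 1) + μ * (c + 1) + 2)))) := by
    intro b c
    convert! (hasSum_betaCoeff_mul_pow_real (κ * (b + 1) + μ * (c + 1)) x0 hx).mul_left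
      ((b + 1 : ℝ) * (c + 1) * (y ^ b * w ^ c)) using 2 with a
    ring
  rw [summable_prod_of_nonneg (fun p => by
    have := (betaCoeff_pos (hpos p.1.1 p.1.2) p.2).le
    simp only [Pi.zero_apply]; positivity)]
  refine ⟨fun p => (hinner p.1 p.2).summable, ?_⟩
  simp only [fun p : ℕ × ℕ => (hinner p.1 p.2).tsum_eq]
  have h1 : 0 < 1 - x := by linarith
  have hY : ‖((y / (1 - x) ^ κ : ℝ) : ℂ)‖ < 1 := by
    rw [Complex.norm_real, Real.norm_eq_abs, abs_of_nonneg (by positivity),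
      div_lt_one (by positivity)]
    exact hy
  have hW : ‖((w / (1 - x) ^ μ : ℝ) : ℂ)‖ < 1 := by
    rw [Complex.norm_real, Real.norm_eq_abs, abs_of_nonneg (by positivity),
      div_lt_one (by positivity)]
    exact hw
  have h2 := ((hasSum_double_series κ μ hY hW).summable).mul_left
    (((1 / (1 - x) ^ (κ + μ + 2) : ℝ)) : ℂ)
  rw [← Complex.summable_ofReal]
  convert! h2 using 2 with p
  norm_cast
  have h3 : (1 - x) ^ (κ * (p.1 + 1) + μ * (p.2 + 1) + 2) =
      (1 - x) ^ (κ + μ + 2) * (((1 - x) ^ κ) ^ p.1 * ((1 - x) ^ μ) ^ p.2) := by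
    rw [← Real.rpow_mul_natCast h1.le, ← Real.rpow_mul_natCast h1.le, ← Real.rpow_add h1,
      ← Real.rpow_add h1]
    congr 1; ring
  push_cast
  rw [h3, div_pow, div_pow]
  field_simp

/-- The closed form of the triple series of the kernel. -/
theorem hasSum_triple_series {κ μ : ℝ} {x y w : ℂ} (hκ : 0 < κ) (hμ : 0 < μ)
    (hx : ‖x‖ < 1) (hy : ‖y‖ < (1 - ‖x‖) ^ κ) (hw : ‖w‖ < (1 - ‖x‖) ^ μ) {T : ℂ}
    (hT : HasSum (fun p : (ℕ × ℕ) × ℕ => (p.1.1 + 1 : ℂ) * (p.1.2 + 1) *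
      (betaCoeff (κ * (p.1.1 + 1) + μ * (p.1.2 + 1)) p.2 : ℂ) *
        (x ^ p.2 * y ^ p.1.1 * w ^ p.1.2)) T) :
    ∃ Y W : ℂ, ‖Y‖ < 1 ∧ ‖W‖ < 1 ∧ T = 1 / (1 - x) ^ (κ + μ + 2 : ℂ) *
      (1 / (1 - Y) ^ 2 * (1 / (1 - W) ^ 2) *
        (κ * ((1 + Y) / (1 - Y)) + μ * ((1 + W) / (1 - W)) + 1)) := by
  have hY := norm_div_one_sub_cpow_lt hκ hx hy
  have hW := norm_div_one_sub_cpow_lt hμ hx hw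
  have hne := one_sub_ne_zero_of_norm_lt hx
  refine ⟨_, _, hY, hW, ?_⟩
  refine HasSum.unique (hT.prod_fiberwise fun p => ?_) ((hasSum_double_series κ μ hY hW).mul_left _)
  have h := (hasSum_betaCoeff_mul_pow (κ * (p.1 + 1) + μ * (p.2 + 1)) hx).mul_left
      ((p.1 + 1 : ℂ) * (p.2 + 1) * (y ^ p.1 * w ^ p.2))
  convert! h using 1
  · ext a; ring
  · push_cast
    -- Only sums and natural multiples of exponents occur, so no branch problem arises for the
    -- nonzero base 1-x.
    have h3 : (1 - x) ^ (κ * (p.1 + 1) + μ * (p.2 + 1) + 2 : ℂ) =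
        (1 - x) ^ (κ + μ + 2 : ℂ) * (((1 - x) ^ (κ : ℂ)) ^ p.1 * ((1 - x) ^ (μ : ℂ)) ^ p.2) := by
      rw [← Complex.cpow_mul_nat, ← Complex.cpow_mul_nat, ← Complex.cpow_add _ _ hne,
        ← Complex.cpow_add _ _ hne]
      congr 1; ring
    rw [h3, div_pow, div_pow]
    have : (1 - x) ^ (κ : ℂ) ≠ 0 := by simp [Complex.cpow_eq_zero_iff, hne]
    have : (1 - x) ^ (μ : ℂ) ≠ 0 := by simp [Complex.cpow_eq_zero_iff, hne]
    have : (1 - x) ^ (κ + μ + 2 : ℂ) ≠ 0 := by simp [Complex.cpow_eq_zero_iff, hne]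
    field_simp

/-- The real part equals (1 - |Y|²) / |1 - Y|². -/
theorem re_one_add_div_one_sub_pos {Y : ℂ} (hY : ‖Y‖ < 1) : 0 < ((1 + Y) / (1 - Y)).re := by
  have hne := one_sub_ne_zero_of_norm_lt hY
  have h1 : 0 < Complex.normSq (1 - Y) := Complex.normSq_pos.mpr hne
  have h2 : Complex.normSq Y < 1 := by
    rw [Complex.normSq_eq_norm_sq]; exact pow_lt_one₀ (norm_nonneg _) hY two_ne_zero
  rw [Complex.div_re, ← add_div]
  refine div_pos ?_ h1
  rw [Complex.normSq_apply] at h2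
  simp only [Complex.add_re, Complex.sub_re, Complex.one_re, Complex.add_im, Complex.sub_im,
    Complex.one_im]
  nlinarith

theorem triple_series_closed_form_ne_zero {κ μ : ℝ} {x Y W : ℂ} (hκ : 0 < κ) (hμ : 0 < μ)
    (hx : ‖x‖ < 1) (hY : ‖Y‖ < 1) (hW : ‖W‖ < 1) :
    1 / (1 - x) ^ (κ + μ + 2 : ℂ) * (1 / (1 - Y) ^ 2 * (1 / (1 - W) ^ 2) *
        (κ * ((1 + Y) / (1 - Y)) + μ * ((1 + W) / (1 - W)) + 1)) ≠ 0 := by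
  have h1 := one_sub_ne_zero_of_norm_lt hx
  have h2 := one_sub_ne_zero_of_norm_lt hY
  have h3 := one_sub_ne_zero_of_norm_lt hW
  have h4 : (1 - x) ^ (κ + μ + 2 : ℂ) ≠ 0 := by simp [Complex.cpow_eq_zero_iff, h1]
  have h5 : κ * ((1 + Y) / (1 - Y)) + μ * ((1 + W) / (1 - W)) + 1 ≠ 0 := by
    intro h
    have := congrArg Complex.re h
    simp only [Complex.add_re, Complex.re_ofReal_mul, Complex.one_re, Complex.zero_re] at this
    have := mul_pos hκ (re_one_add_div_one_sub_pos hY)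
    have := mul_pos hμ (re_one_add_div_one_sub_pos hW)
    linarith
  exact mul_ne_zero (one_div_ne_zero h4) (mul_ne_zero (mul_ne_zero
    (one_div_ne_zero (pow_ne_zero _ h2)) (one_div_ne_zero (pow_ne_zero _ h3))) h5)

/-! ### The domain and the norms of its monomials. -/

section

/-- The integral of a function of the modulus over the plane in polar coordinates. -/
theorem integral_norm_complex (f : ℝ → ℝ) :
    ∫ z : ℂ, f ‖z‖ = 2 * Real.pi * ∫ y in Set.Ioi (0 : ℝ), y * f y := by
  rw [integral_fun_norm_addHaar volume f, Complex.finrank_real_complex]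
  have : (volume : Measure ℂ).real (Metric.ball 0 1) = Real.pi := by
    rw [Measure.real, Complex.volume_ball]; simp
  rw [this]
  simp [mul_assoc]

/-- Applied with ρ = 1 - |z₁|²; the case ρ ≤ 0 is the empty slice. In polar coordinates the disc has
radius ρ^(1/q). -/
theorem integral_disc_norm_pow {q ρ : ℝ} (hq : 0 < q) (b : ℕ) :
    ∫ v : ℂ, (if ‖v‖ ^ q < ρ then ‖v‖ ^ (2 * b) else 0) =
      if 0 < ρ then Real.pi / (b + 1) * ρ ^ (2 / q * (b + 1)) else 0 := by
  rw [integral_norm_complex fun y => if y ^ q < ρ then y ^ (2 * b) else 0]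
  split_ifs with hρ
  · set R := ρ ^ q⁻¹
    have hR : 0 < R := Real.rpow_pos_of_pos hρ _
    have h1 : ∫ y in Set.Ioi (0 : ℝ), y * (if y ^ q < ρ then y ^ (2 * b) else 0) =
        ∫ y in Set.Ioi (0 : ℝ), (Set.Iio R).indicator (fun y => y ^ (2 * b + 1)) y := by
      refine setIntegral_congr_fun measurableSet_Ioi fun y hy => ?_
      have h : y ^ q < ρ ↔ y < R := (Real.lt_rpow_inv_iff_of_pos (le_of_lt hy) hρ.le hq).symm
      simp only [Set.indicator, Set.mem_Iio, h, mul_ite, mul_zero, pow_succ']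
    rw [h1, setIntegral_indicator measurableSet_Iio, Set.Ioi_inter_Iio,
      ← integral_Ioc_eq_integral_Ioo, ← intervalIntegral.integral_of_le hR.le, integral_pow]
    have h2 : ρ ^ (2 / q * (b + 1)) = R ^ (2 * b + 1 + 1) := by
      rw [← Real.rpow_mul_natCast hρ.le]
      congr 1; push_cast; field_simp; ring
    rw [h2]
    push_cast
    have : (b : ℝ) + 1 ≠ 0 := by positivity
    rw [zero_pow (by omega)]
    field_simp; ring
  · have h1 : ∫ y in Set.Ioi (0 : ℝ), y * (if y ^ q < ρ then y ^ (2 * b) else 0) = 0 := by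
      refine setIntegral_eq_zero_of_forall_eq_zero fun y hy => ?_
      have : ¬ y ^ q < ρ := by
        have := Real.rpow_nonneg (le_of_lt hy) q
        linarith
      simp [this]
    rw [h1, mul_zero]

/-- Polar coordinates and t = y² reduce this to the Beta integral; `C` carries the constant from the
slices. -/
theorem integral_disc_norm_pow_mul_rpow {s : ℝ} (hs : 0 ≤ s) (a : ℕ) (C : ℝ) :
    ∫ u : ℂ, (if ‖u‖ < 1 then ‖u‖ ^ (2 * a) * (C * (1 - ‖u‖ ^ 2) ^ s) else 0) =
      Real.pi * C / betaCoeff s a := by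
  rw [integral_norm_complex fun y => if y < 1 then y ^ (2 * a) * (C * (1 - y ^ 2) ^ s) else 0]
  have h1 : ∫ y in Set.Ioi (0 : ℝ), y * (if y < 1 then y ^ (2 * a) * (C * (1 - y ^ 2) ^ s) else 0) =
      ∫ y in Set.Ioi (0 : ℝ), (Set.Iio 1).indicator
        (fun y => C / 2 * (((y ^ 2) ^ a * (1 - y ^ 2) ^ s) * (2 * y))) y := by
    refine setIntegral_congr_fun measurableSet_Ioi fun y hy => ?_
    simp only [Set.indicator, Set.mem_Iio, mul_ite, mul_zero]
    refine if_congr Iff.rfl ?_ rfl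
    rw [pow_mul]; ring
  rw [h1, setIntegral_indicator measurableSet_Iio, Set.Ioi_inter_Iio,
    ← integral_Ioc_eq_integral_Ioo, ← intervalIntegral.integral_of_le zero_le_one,
    intervalIntegral.integral_const_mul]
  have h2 := intervalIntegral.integral_comp_mul_deriv (a := 0) (b := 1) (f := fun y : ℝ => y ^ 2)
    (f' := fun y => 2 * y) (g := fun t : ℝ => t ^ a * (1 - t) ^ s)
    (fun y _ => by simpa using hasDerivAt_pow 2 y) (by fun_prop)
    ((continuous_pow a).mul ((continuous_const.sub continuous_id).rpow_const fun _ => Or.inr hs))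
  simp only [Function.comp_def] at h2
  rw [h2]
  norm_num
  rw [integral_pow_mul_one_sub_rpow hs]
  field_simp

/-- The intersection of two cylinders over complex ellipsoids, with exponents `q 0` and `q 1`. -/
def ellipsoidIntersection (q : Fin 2 → ℝ) : Set (Fin 3 → ℂ) :=
  {z | ∀ i, ‖z 0‖ ^ 2 + ‖z i.succ‖ ^ q i < 1}

variable {q : Fin 2 → ℝ}

theorem isOpen_ellipsoidIntersection (hq : ∀ i, 0 < q i) : IsOpen (ellipsoidIntersection q) := by
  simp only [ellipsoidIntersection, Set.ofPred_forall]
  refine isOpen_iInter_of_finite fun i => isOpen_lt ?_ continuous_const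
  exact ((continuous_apply 0).norm.pow 2).add
    ((continuous_apply i.succ).norm.rpow_const fun _ => Or.inr (hq i).le)

theorem isCompleteReinhardt_ellipsoidIntersection (hq : ∀ i, 0 < q i) :
    IsCompleteReinhardt (ellipsoidIntersection q) := by
  intro z hz w hw i
  refine lt_of_le_of_lt ?_ (hz i)
  exact add_le_add (pow_le_pow_left₀ (norm_nonneg _) (hw 0) 2)
    (Real.rpow_le_rpow (norm_nonneg _) (hw _) (hq i).le)

theorem zero_mem_ellipsoidIntersection (hq : ∀ i, 0 < q i) :
    (0 : Fin 3 → ℂ) ∈ ellipsoidIntersection q := by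
  intro i
  simp [Real.zero_rpow (hq i).ne']

theorem norm_apply_lt_one_of_mem (hq : ∀ i, 0 < q i) {z : Fin 3 → ℂ}
    (hz : z ∈ ellipsoidIntersection q) (i : Fin 3) : ‖z i‖ < 1 := by
  refine Fin.cases ?_ (fun j => ?_) i
  · have h1 := hz 0
    have h2 := Real.rpow_nonneg (norm_nonneg (z (Fin.succ 0))) (q 0)
    by_contra! h
    nlinarith
  · have h1 := hz j
    by_contra! h
    have := Real.one_le_rpow h (hq j).le
    nlinarith [sq_nonneg ‖z 0‖]

theorem isConnected_ellipsoidIntersection (hq : ∀ i, 0 < q i) :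
    IsConnected (ellipsoidIntersection q) := by
  have hstar : StarConvex ℝ (0 : Fin 3 → ℂ) (ellipsoidIntersection q) := by
    rw [starConvex_zero_iff]
    intro z hz t h0 h1
    refine isCompleteReinhardt_ellipsoidIntersection hq z hz _ fun i => ?_
    rw [Pi.smul_apply, norm_smul, Real.norm_eq_abs, abs_of_nonneg h0]
    exact mul_le_of_le_one_left (norm_nonneg _) h1
  exact (hstar.isPathConnected (zero_mem_ellipsoidIntersection hq)).isConnected

theorem norm_monomialFun_le_one (hq : ∀ i, 0 < q i) (α : Fin 3 → ℕ) {z : Fin 3 → ℂ}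
    (hz : z ∈ ellipsoidIntersection q) : ‖monomialFun α z‖ ≤ 1 := by
  rw [monomialFun, norm_prod]
  refine Finset.prod_le_one (fun _ _ => norm_nonneg _) fun i _ => ?_
  rw [norm_pow]
  exact pow_le_one₀ (norm_nonneg _) (norm_apply_lt_one_of_mem hq hz i).le

theorem volume_ellipsoidIntersection_lt_top (hq : ∀ i, 0 < q i) :
    volume (ellipsoidIntersection q) < ⊤ := by
  refine lt_of_le_of_lt (measure_mono fun z hz => ?_)
    (measure_ball_lt_top (μ := volume) (x := (0 : Fin 3 → ℂ)) (r := 1))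
  rw [mem_ball_zero_iff, pi_norm_lt_iff one_pos]
  exact norm_apply_lt_one_of_mem hq hz

theorem memLp_monomialFun (hq : ∀ i, 0 < q i) (α : Fin 3 → ℕ) :
    MemLp (monomialFun α) 2 (volume.restrict (ellipsoidIntersection q)) := by
  have : IsFiniteMeasure (volume.restrict (ellipsoidIntersection q)) :=
    ⟨by simpa using volume_ellipsoidIntersection_lt_top hq⟩
  refine MemLp.of_bound (differentiable_monomialFun α).continuous.aestronglyMeasurable 1 ?_
  filter_upwards [ae_restrict_mem (isOpen_ellipsoidIntersection hq).measurableSet] with z hz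
  exact norm_monomialFun_le_one hq α hz

/-- The squared norms of the monomials. -/
theorem integral_norm_monomialFun_sq (hq : ∀ i, 0 < q i) (α : Fin 3 → ℕ) :
    ∫ z in ellipsoidIntersection q, ‖monomialFun α z‖ ^ 2 =
      Real.pi ^ 3 / ((α 1 + 1) * (α 2 + 1) *
        betaCoeff (2 / q 0 * (α 1 + 1) + 2 / q 1 * (α 2 + 1)) (α 0)) := by
  classical
  set D := ellipsoidIntersection q
  have hDm : MeasurableSet D := (isOpen_ellipsoidIntersection hq).measurableSet
  set f : Fin 2 → ℂ → ℂ → ℝ := fun i u v =>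
    if ‖v‖ ^ q i < 1 - ‖u‖ ^ 2 then ‖v‖ ^ (2 * α i.succ) else 0
  -- For fixed first coordinate the two defining inequalities are independent, so the integrand
  -- extended by zero is a product of functions of one variable each.
  set G : ℂ × (Fin 2 → ℂ) → ℝ := fun p => ‖p.1‖ ^ (2 * α 0) * ∏ i, f i p.1 (p.2 i)
  have hG : ∀ z : Fin 3 → ℂ, D.indicator (fun z => ‖monomialFun α z‖ ^ 2) z =
      G (MeasurableEquiv.piFinSuccAbove (fun _ : Fin 3 => ℂ) 0 z) := by
    intro z
    have h1 : MeasurableEquiv.piFinSuccAbove (fun _ : Fin 3 => ℂ) 0 z =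
      (z 0, fun i => z i.succ) := rfl
    rw [h1]
    simp only [G, f]
    by_cases hz : z ∈ D
    · rw [Set.indicator_of_mem hz]
      have h2 : ∀ i : Fin 2, ‖z i.succ‖ ^ q i < 1 - ‖z 0‖ ^ 2 := fun i => by
        have := hz i; linarith
      simp only [h2, if_true]
      rw [monomialFun, Fin.prod_univ_succ, norm_mul, norm_prod, mul_pow, ← Finset.prod_pow]
      simp only [norm_pow, ← pow_mul, mul_comm 2]
    · rw [Set.indicator_of_notMem hz]
      have : ∃ i : Fin 2, ¬ ‖z i.succ‖ ^ q i < 1 - ‖z 0‖ ^ 2 := by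
        by_contra! h
        exact hz fun i => by have := h i; linarith
      obtain ⟨i, hi⟩ := this
      rw [Finset.prod_eq_zero (Finset.mem_univ i) (if_neg hi), mul_zero]
  have hmp := volume_preserving_piFinSuccAbove (fun _ : Fin 3 => ℂ) 0
  have hint : IntegrableOn (fun z => ‖monomialFun α z‖ ^ 2) D :=
    (memLp_monomialFun hq α).integrable_norm_pow (by norm_num)
  have hGint : Integrable G (volume.prod volume) := by
    rw [← integrable_indicator_iff hDm] at hint
    rw [show D.indicator (fun z => ‖monomialFun α z‖ ^ 2) = G ∘ _ from funext hG] at hint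
    exact (hmp.integrable_comp_emb (MeasurableEquiv.measurableEmbedding _)).mp hint
  rw [← integral_indicator hDm]
  simp only [hG]
  rw [hmp.integral_comp' G]
  change ∫ p, G p ∂(volume.prod volume) = _
  rw [integral_prod _ hGint]
  set s := 2 / q 0 * (α 1 + 1) + 2 / q 1 * (α 2 + 1) with hs
  have hq0 := hq 0
  have hq1 := hq 1
  have hs0 : 0 ≤ s := by positivity
  have hinner : ∀ u : ℂ, ∫ v : Fin 2 → ℂ, G (u, v) =
      if ‖u‖ < 1 then ‖u‖ ^ (2 * α 0) *
        (Real.pi ^ 2 / ((α 1 + 1) * (α 2 + 1)) * (1 - ‖u‖ ^ 2) ^ s) else 0 := by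
    intro u
    simp only [G]
    rw [integral_const_mul, integral_fintype_prod_volume_eq_prod]
    simp only [f, integral_disc_norm_pow (hq _), Fin.prod_univ_two]
    have h1 : 0 < 1 - ‖u‖ ^ 2 ↔ ‖u‖ < 1 := by
      rw [sub_pos, sq_lt_one_iff₀ (norm_nonneg _)]
    simp only [h1]
    split_ifs with h
    · have h2 := h1.mpr h
      rw [hs, Real.rpow_add h2]
      simp only [Fin.succ_zero_eq_one, Fin.succ_one_eq_two]
      field_simp
    · simp
  simp only [hinner]
  rw [integral_disc_norm_pow_mul_rpow hs0]
  have := (betaCoeff_pos hs0 (α 0)).ne'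
  field_simp

end

/-! ### Nonvanishing of the kernel. -/

section

variable {q : Fin 2 → ℝ}

/-- After raising to the power `q i`, multiply the defining inequalities of `z` and `w` and use
(1-A²)(1-B²) ≤ (1-AB)², which amounts to (A-B)² ≥ 0. -/
theorem norm_mul_norm_lt_one_sub_rpow (hq : ∀ i, 0 < q i) {z w : Fin 3 → ℂ}
    (hz : z ∈ ellipsoidIntersection q) (hw : w ∈ ellipsoidIntersection q) (i : Fin 2) :
    ‖z i.succ‖ * ‖w i.succ‖ < (1 - ‖z 0‖ * ‖w 0‖) ^ (2 / q i) := by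
  have hqi := hq i
  have hX : 0 < 1 - ‖z 0‖ * ‖w 0‖ := by
    have h1 := norm_apply_lt_one_of_mem hq hz 0
    have h2 := norm_apply_lt_one_of_mem hq hw 0
    nlinarith [norm_nonneg (z 0), norm_nonneg (w 0)]
  rw [← Real.rpow_lt_rpow_iff (z := q i) (by positivity) (by positivity) hqi,
    ← Real.rpow_mul hX.le, div_mul_cancel₀ _ hqi.ne', Real.rpow_two,
    Real.mul_rpow (norm_nonneg _) (norm_nonneg _)]
  have h1 : ‖z i.succ‖ ^ q i < 1 - ‖z 0‖ ^ 2 := by have := hz i; linarith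
  have h2 : ‖w i.succ‖ ^ q i < 1 - ‖w 0‖ ^ 2 := by have := hw i; linarith
  have h3 := mul_lt_mul'' h1 h2 (by positivity) (by positivity)
  nlinarith [sq_nonneg (‖z 0‖ - ‖w 0‖)]

/-- Multi-indices of length three, with the first entry split off. -/
def multiIndexEquiv : (Fin 3 → ℕ) ≃ (ℕ × ℕ) × ℕ where
  toFun α := ((α 1, α 2), α 0)
  invFun p := ![p.2, p.1.1, p.1.2]
  left_inv α := by ext i; fin_cases i <;> rfl
  right_inv p := rfl

theorem multiIndexEquiv_apply (α : Fin 3 → ℕ) : multiIndexEquiv α = ((α 1, α 2), α 0) := rfl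

theorem isLuQiKengDomain_ellipsoidIntersection (hq : ∀ i, 0 < q i) :
    IsLuQiKengDomain (ellipsoidIntersection q) := by
  have hD := isOpen_ellipsoidIntersection hq
  have hκ : 0 < 2 / q 0 := div_pos two_pos (hq 0)
  have hμ : 0 < 2 / q 1 := div_pos two_pos (hq 1)
  have hx : ∀ {z w : Fin 3 → ℂ}, z ∈ ellipsoidIntersection q → w ∈ ellipsoidIntersection q →
      ‖z 0‖ * ‖w 0‖ < 1 := fun hz hw =>
    mul_lt_one_of_nonneg_of_lt_one_left (norm_nonneg _) (norm_apply_lt_one_of_mem hq hz 0)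
      (norm_apply_lt_one_of_mem hq hw 0).le
  obtain ⟨K, hK, hsum⟩ :=
    (isCompleteReinhardt_ellipsoidIntersection hq).exists_isBergmanKernel_hasSum hD
      (zero_mem_ellipsoidIntersection hq) (memLp_monomialFun hq) (fun α => by
        rw [integral_norm_monomialFun_sq hq]
        have := betaCoeff_pos (s := 2 / q 0 * (α 1 + 1) + 2 / q 1 * (α 2 + 1))
          (by positivity) (α 0)
        positivity) (fun w hw => by
        have h := summable_triple_series hκ hμ (x := ‖w 0‖ * ‖w 0‖) (y := ‖w 1‖ * ‖w 1‖)
          (w := ‖w 2‖ * ‖w 2‖) (by positivity) (by positivity) (by positivity) (hx hw hw)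
          (norm_mul_norm_lt_one_sub_rpow hq hw hw 0) (norm_mul_norm_lt_one_sub_rpow hq hw hw 1)
        have h2 := (multiIndexEquiv.summable_iff.mpr h).mul_left (Real.pi ^ 3)⁻¹
        convert! h2 using 2 with α
        rw [integral_norm_monomialFun_sq hq, monomialFun, Fin.prod_univ_three]
        simp only [multiIndexEquiv_apply, Function.comp_apply, norm_mul, norm_pow]
        field_simp
        ring)
  refine ⟨hD, isConnected_ellipsoidIntersection hq, K, hK, fun z hz w hw => ?_⟩
  have hpi : (Real.pi : ℂ) ≠ 0 := by exact_mod_cast Real.pi_ne_zero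
  -- Convergence off the diagonal comes from the kernel expansion; only the factor π³ and the order
  -- of summation are changed.
  have hT : HasSum (fun p : (ℕ × ℕ) × ℕ => (p.1.1 + 1 : ℂ) * (p.1.2 + 1) *
      (betaCoeff (2 / q 0 * (p.1.1 + 1) + 2 / q 1 * (p.1.2 + 1)) p.2 : ℂ) *
        ((z 0 * conj (w 0)) ^ p.2 * (z 1 * conj (w 1)) ^ p.1.1 * (z 2 * conj (w 2)) ^ p.1.2))
      ((Real.pi : ℂ) ^ 3 * K z w) := by
    rw [← multiIndexEquiv.hasSum_iff]
    convert! (hsum z hz w hw).mul_left ((Real.pi : ℂ) ^ 3) using 1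
    ext α
    rw [integral_norm_monomialFun_sq hq, monomialFun, monomialFun, Fin.prod_univ_three,
      Fin.prod_univ_three]
    simp only [multiIndexEquiv_apply, Function.comp_apply, map_mul, map_pow]
    push_cast
    field_simp
    ring
  have hnorm : ∀ i, ‖z i * conj (w i)‖ = ‖z i‖ * ‖w i‖ := fun i => by
    rw [norm_mul, RCLike.norm_conj]
  have hx' : ‖z 0 * conj (w 0)‖ < 1 := by rw [hnorm]; exact hx hz hw
  obtain ⟨Y, W, hY, hW, h⟩ := hasSum_triple_series hκ hμ hx'
    (by rw [hnorm, hnorm]; exact norm_mul_norm_lt_one_sub_rpow hq hz hw 0)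
    (by rw [hnorm, hnorm]; exact norm_mul_norm_lt_one_sub_rpow hq hz hw 1) hT
  have hne := triple_series_closed_form_ne_zero hκ hμ hx' hY hW
  rw [← h] at hne
  exact right_ne_zero_of_mul hne

end

theorem theorem1 (q r : ℝ) (hq : 0 < q) (hr : 0 < r) :
    IsLuQiKengDomain
      {z : Fin 3 → ℂ | ‖z 0‖ ^ 2 + ‖z 1‖ ^ q < 1 ∧ ‖z 0‖ ^ 2 + ‖z 2‖ ^ r < 1} := by
  have h := isLuQiKengDomain_ellipsoidIntersection (q := ![q, r])
    (Fin.forall_fin_two.mpr ⟨hq, hr⟩)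
  convert h using 1
  ext z
  exact (Fin.forall_fin_two (p := fun i => ‖z 0‖ ^ 2 + ‖z i.succ‖ ^ (![q, r] i) < 1)).symm
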